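/- All graphs are finite, undirected and without loops or multiple edges. A graph is reduced if distinct vertices have distinct neighbourhoods. Graphs $\Gamma_1=(V_1,E_1)$ and $\Gamma_2=(V_2,E_2)$ are TF-isomorphic if there are bijections $\pi_1,\pi_2\colon V_1\to V_2$ such that for all $v,w\in V_1$: $(v,w)\in E_1$ if and only if $(\pi_1(v),\pi_2(w))\in E_2$. A graph $\Gamma$ is stable if $\mathrm{Aut}(\Gamma\times K_2)\cong \mathrm{Aut}(\Gamma)\times\mathbb{Z}_2$, where $\Gamma\times K_2$ is the direct product with the complete graph $K_2$ (the canonical double cover of $\Gamma$). For a group $H$ and $S\subseteq H\setminus\{e\}$ with $S^{-1}=S$, the Cayley graph $\mathrm{Cay}(H,S)$ has vertex set $H$, with $h_1$ and $h_2$ adjacent if and only if $h_1^{-1}h_2\in S$; it is a graphical regular representation (GRR) of $H$ if its automorphism group is isomorphic to $H$. Theorem. For every integer $k\ge 13$ there exists a connected, reduced, nonbipartite graph $\Gamma$ of valency $2k+2$ that is a GRR of $\mathbb{Z}_2^k$ and such that, up to isomorphism, there are exactly $2^k-2k-2$ graphs TF-isomorphic to $\Gamma$ (counting $\Gamma$ itself).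 Moreover, every graph TF-isomorphic to $\Gamma$ is stable and is isomorphic to a Cayley graph of $\mathbb{Z}_2^k$. -/

import Mathlib

namespace TwoFold

open SimpleGraph

universe u v w

/-- A graph is reduced (twin-free) if distinct vertices have distinct neighbourhoods. -/
def IsReduced {V : Type u} (G : SimpleGraph V) : Prop :=
  ∀ x y : V, G.neighborSet x = G.neighborSet y → x = y

/-- A graph has valency `d` if every vertex has exactly `d` neighbours
(used for `d ≠ 0` and finite graphs). -/
def HasValency {V : Type u} (G : SimpleGraph V) (d : ℕ) : Prop :=
  ∀ x : V, (G.neighborSet x).ncard = d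

/-- Two-fold isomorphism: bijections `π₁, π₂ : V₁ → V₂` such that
`x ~ y` in the first graph iff `π₁ x ~ π₂ y` in the second. -/
def TFIsomorphic {V : Type u} {W : Type v} (G : SimpleGraph V) (G' : SimpleGraph W) : Prop :=
  ∃ π₁ π₂ : V ≃ W, ∀ x y : V, G.Adj x y ↔ G'.Adj (π₁ x) (π₂ y)

/-- `G` is stable if `Aut (G × K₂) ≅ Aut G × ℤ₂`. The canonical double cover `G × K₂` is
`G.bipartiteDoubleCover`, on the vertex set `V ⊕ V`, that is, two copies of `V`. -/
def IsStable {V : Type u} (G : SimpleGraph V) : Prop :=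
  Nonempty ((G.bipartiteDoubleCover ≃g G.bipartiteDoubleCover) ≃*
    ((G ≃g G) × Multiplicative (ZMod 2)))

/-- `G` is (isomorphic to) a Cayley graph `Cay(H, S)` with `1 ∉ S` and `S⁻¹ = S`.
For such `S`, `mulCayley S` is the graph on `H` with `a ~ b` iff `a⁻¹ * b ∈ S`. -/
def IsCayleyGraphOf (H : Type w) [Group H] {V : Type u} (G : SimpleGraph V) : Prop :=
  ∃ S : Set H, (1 : H) ∉ S ∧ (∀ s ∈ S, s⁻¹ ∈ S) ∧ Nonempty (G ≃g mulCayley S)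

/-- `G` is a graphical regular representation of `H`: a Cayley graph of `H` whose automorphism
group is isomorphic to `H`. -/
def IsGRR (H : Type w) [Group H] {V : Type u} (G : SimpleGraph V) : Prop :=
  IsCayleyGraphOf H G ∧ Nonempty ((G ≃g G) ≃* H)

/-- The elementary abelian group `ℤ₂ ^ k`, written multiplicatively. -/
abbrev Z2Pow (k : ℕ) : Type := Multiplicative (Fin k → ZMod 2)

end TwoFold

/-!
Let `S` be a subset of `A = ℤ₂ ^ k` without the identity, and let `Γ` be its Cayley graph. Everything
follows from two properties of `S`: the products `s * t` of two elements of `S` generate `A`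
(`PairGenerates`), and the two-fold automorphisms of `Γ` are just the pairs `(π, π)` with `π` a
translation (`TFRigid`).

Indeed, the first property makes the canonical double cover connected, so its automorphisms are the
two-fold automorphisms, possibly composed with the interchange of the sheets; by the second property
they form the group `A × ℤ₂` (`TFRigid.isStable`), while `Aut Γ` is `A`. If `(π₁, π₂)` is a two-fold
isomorphism from `Γ` to `G`, then `π₁` and `π₂` differ by a two-fold automorphism, hence by
a translation, so `G` is the Cayley graph of a translate `a S` (`TFRigid.exists_iso_shift`); it has
no loops exactly when `a ∉ S`, and different `a` give nonisomorphic graphs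
(`TFRigid.shift_iso_unique`). This gives `2 ^ k - |S|` graphs. Translates of `S` inherit
both properties, so all these graphs are stable.

Rigidity is a local matter. Call `s, t ∈ S` linked if `s * t = u * w` for another pair `u, w` in `S`,
that is, if `s` and `t` have more than the two obvious common neighbours. The permutation of `S` that
a two-fold automorphism induces at a vertex preserves linked pairs. If only the identity does so, then
a two-fold automorphism looks like a translation at every vertex, and so is one
(`tfRigid_of_linked`).

To construct `S`, with `2 (k + 1)` elements, take a system of `k + 1` triples on `k + 1` points. The
indicator vectors of points and triples are `2 (k + 1)` vectors of odd weight in `ℤ₂ ^ (k + 1)`, and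
the odd vectors form an affine space over `ℤ₂ ^ k`. If distinct triples share at most one point
and no triple is the sum of three others, then the only coincidences of sums of two come from
a triple being the sum of its points. So a point and a triple are linked if they are
incident, two points if they lie on a common triple, and two triples never. If moreover every point
lies on two triples, the triples are recognized as the elements whose neighbourhood is a clique, and
a permutation preserving linked pairs is an automorphism of the triple system
(`IsSparse.eq_of_cellLinked`). It remains to exhibit, for `k ≥ 13`, such a triple system without
nontrivial automorphisms (`triples`, `isSparse_triples`, `triples_asymmetric`).
-/

/-! ### Rigid connection sets in groups of exponent two -/

namespace TwoFold

open SimpleGraph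

variable {A : Type*} [CommGroup A]

/-- Every two-fold automorphism of the Cayley graph with connection set `S` (over a group of
exponent two) is a pair of equal translations. -/
def TFRigid (S : Set A) : Prop :=
  ∀ π₁ π₂ : A ≃ A, (∀ x y, x * y ∈ S ↔ π₁ x * π₂ y ∈ S) →
    ∃ a, (∀ x, π₁ x = a * x) ∧ ∀ x, π₂ x = a * x

/-- The products `s * t` with `s, t ∈ S` generate the group, stated as an induction principle. -/
def PairGenerates (S : Set A) : Prop :=
  ∀ Q : A → Prop, Q 1 → (∀ x, Q x → ∀ s ∈ S, ∀ t ∈ S, Q (x * (s * t))) → ∀ x, Q x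

/-- The translate `a⁻¹ S` of a connection set. -/
def shiftSet (S : Set A) (a : A) : Set A := {x | a * x ∈ S}

section

variable (hA : ∀ x : A, x * x = 1)
include hA

theorem mul_self_mul (x y : A) : x * (x * y) = y := by
  rw [← mul_assoc, hA, one_mul]

theorem inv_eq_self_of_exponent_two (x : A) : x⁻¹ = x := inv_eq_of_mul_eq_one_left (hA x)

theorem cayley_adj {S : Set A} (h1 : (1 : A) ∉ S) (x y : A) :
    (mulCayley S).Adj x y ↔ x * y ∈ S := by
  rw [mulCayley_adj, inv_eq_self_of_exponent_two hA, inv_eq_self_of_exponent_two hA, mul_comm y x,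
    or_self]
  refine ⟨fun h => h.2, fun h => ⟨?_, h⟩⟩
  rintro rfl
  exact h1 (hA x ▸ h)

theorem TFRigid.shift {S : Set A} (hS : TFRigid S) (a : A) : TFRigid (shiftSet S a) := by
  intro π₁ π₂ h
  obtain ⟨b, h₁, h₂⟩ := hS π₁ (((Equiv.mulLeft a).trans π₂).trans (Equiv.mulLeft a)) (by
    intro x y
    have := h x (a * y)
    simp only [shiftSet, Set.mem_ofPred_eq] at this
    rw [mul_left_comm x a y, mul_self_mul hA, mul_left_comm a] at this
    simpa using this)
  refine ⟨b, h₁, fun x => ?_⟩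
  have := h₂ (a * x)
  simp only [Equiv.trans_apply, Equiv.coe_mulLeft, mul_self_mul hA] at this
  rw [← mul_self_mul hA a (π₂ x), this, mul_left_comm b a x, mul_self_mul hA]

theorem PairGenerates.shift {S : Set A} (hS : PairGenerates S) (a : A) :
    PairGenerates (shiftSet S a) := by
  intro Q h1 hQ
  refine hS Q h1 fun x hx s hs t ht => ?_
  have := hQ x hx (a * s) (by simpa [shiftSet, mul_self_mul hA]) (a * t)
    (by simpa [shiftSet, mul_self_mul hA])
  rwa [mul_mul_mul_comm a s a t, hA, one_mul] at this

/-- A rigid connection set is not invariant under a nontrivial translation: otherwise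
interchanging two twins on one side only would be a two-fold automorphism. -/
theorem TFRigid.isReduced {S : Set A} (hS : TFRigid S) (h1 : (1 : A) ∉ S) :
    IsReduced (mulCayley S) := by
  classical
  intro x y hxy
  have key : ∀ z, x * z ∈ S ↔ y * z ∈ S := fun z => by
    have := Set.ext_iff.1 hxy z
    simpa [mem_neighborSet, cayley_adj hA h1] using this
  obtain ⟨a, ha, hb⟩ := hS (Equiv.swap x y) (Equiv.refl A) (by
    intro z w
    by_cases hz : z = x
    · subst hz; simpa using key w
    by_cases hz' : z = y
    · subst hz'; simpa using (key w).symm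
    rw [Equiv.swap_apply_of_ne_of_ne hz hz']; rfl)
  have h₁ := hb 1
  simp only [Equiv.refl_apply, mul_one] at h₁
  have h₂ := ha x
  rw [← h₁, one_mul, Equiv.swap_apply_left] at h₂
  exact h₂.symm

theorem PairGenerates.connected {S : Set A} (hS : PairGenerates S) (h1 : (1 : A) ∉ S) :
    (mulCayley S).Connected := by
  have h : ∀ x, (mulCayley S).Reachable 1 x := by
    refine hS _ (Reachable.refl 1) fun x hx s hs t ht => ?_
    have e₁ : (mulCayley S).Adj x (x * s) := by
      rw [cayley_adj hA h1, mul_self_mul hA]; exact hs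
    have e₂ : (mulCayley S).Adj (x * s) (x * (s * t)) := by
      rw [cayley_adj hA h1, mul_mul_mul_comm, hA, one_mul, mul_self_mul hA]; exact ht
    exact hx.trans (e₁.reachable.trans e₂.reachable)
  have : Nonempty A := ⟨1⟩
  exact ⟨fun x y => (h x).symm.trans (h y)⟩

theorem PairGenerates.not_isBipartite {S : Set A} (hS : PairGenerates S) (h1 : (1 : A) ∉ S)
    (hne : S.Nonempty) : ¬ (mulCayley S).IsBipartite := by
  rintro ⟨c⟩
  have h : ∀ x, c x = c 1 := by
    refine hS _ rfl fun x hx s hs t ht => ?_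
    have e₁ : (mulCayley S).Adj x (x * s) := by
      rw [cayley_adj hA h1, mul_self_mul hA]; exact hs
    have e₂ : (mulCayley S).Adj (x * s) (x * (s * t)) := by
      rw [cayley_adj hA h1, mul_mul_mul_comm, hA, one_mul, mul_self_mul hA]; exact ht
    have n₁ := c.valid e₁
    have n₂ := c.valid e₂
    grind
  obtain ⟨s, hs⟩ := hne
  have e : (mulCayley S).Adj 1 s := by rw [cayley_adj hA h1, one_mul]; exact hs
  exact c.valid e (h s).symm

theorem hasValency_cayley {S : Set A} (h1 : (1 : A) ∉ S) {d : ℕ} (hd : S.ncard = d) :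
    HasValency (mulCayley S) d := by
  intro x
  have : (mulCayley S).neighborSet x = (fun y => x * y) '' S := by
    ext y
    rw [mem_neighborSet, cayley_adj hA h1]
    refine ⟨fun h => ⟨x * y, h, mul_self_mul hA x y⟩, ?_⟩
    rintro ⟨z, hz, rfl⟩
    simpa [mul_self_mul hA] using hz
  rw [this, Set.ncard_image_of_injective _ (mul_right_injective x), hd]

/-- Translation by `a` as an automorphism of the Cayley graph. -/
def translation {S : Set A} (h1 : (1 : A) ∉ S) : A →* (mulCayley S ≃g mulCayley S) where
  toFun a :=
    { toEquiv := Equiv.mulLeft a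
      map_rel_iff' := by
        intro x y
        simp [cayley_adj hA h1, mul_mul_mul_comm a x a y, hA] }
  map_one' := by ext x; simp
  map_mul' a b := by ext x; simp

theorem translation_apply {S : Set A} (h1 : (1 : A) ∉ S) (a x : A) :
    translation hA h1 a x = a * x := rfl

theorem TFRigid.translation_bijective {S : Set A} (hS : TFRigid S) (h1 : (1 : A) ∉ S) :
    Function.Bijective (translation hA h1) := by
  constructor
  · intro a b h
    have := DFunLike.congr_fun h 1
    simpa [translation_apply] using this
  · intro φ
    obtain ⟨a, ha, -⟩ := hS φ.toEquiv φ.toEquiv (by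
      intro x y
      rw [← cayley_adj hA h1, ← cayley_adj hA h1]
      exact φ.map_rel_iff.symm)
    refine ⟨a, ?_⟩
    ext x
    exact (ha x).symm

theorem TFRigid.isGRR {S : Set A} (hS : TFRigid S) (h1 : (1 : A) ∉ S) :
    IsGRR A (mulCayley S) :=
  ⟨⟨S, h1, fun s hs => by rwa [inv_eq_self_of_exponent_two hA], ⟨Iso.refl⟩⟩,
    ⟨(MulEquiv.ofBijective _ (hS.translation_bijective hA h1)).symm⟩⟩

end

/-- Conjugation by a graph isomorphism. -/
def autCongr {X Y : Type*} {K : SimpleGraph X} {K' : SimpleGraph Y} (f : K ≃g K') :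
    (K ≃g K) ≃* (K' ≃g K') where
  toFun φ := (f.symm.trans φ).trans f
  invFun φ := (f.trans φ).trans f.symm
  left_inv φ := by ext x; simp
  right_inv φ := by ext x; simp
  map_mul' φ ψ := by ext x; simp

theorem IsStable.congr {V W : Type*} {G : SimpleGraph V} {G' : SimpleGraph W} (e : G ≃g G')
    (h : IsStable G) : IsStable G' := by
  let E : G.bipartiteDoubleCover ≃g G'.bipartiteDoubleCover :=
    { toEquiv := Equiv.sumCongr e.toEquiv e.toEquiv
      map_rel_iff' := by
        rintro (x | x) (y | y) <;> simp [Iso.map_adj_iff] }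
  obtain ⟨m⟩ := h
  exact ⟨(autCongr E).symm.trans (m.trans ((autCongr e).prodCongr (MulEquiv.refl _)))⟩

theorem multiplicative_zmod_two (ε : Multiplicative (ZMod 2)) :
    ε = 1 ∨ ε = Multiplicative.ofAdd 1 := by
  revert ε; decide

section

variable (hA : ∀ x : A, x * x = 1) {S : Set A} (h1 : (1 : A) ∉ S)

/-- The automorphism of the double cover that translates both sheets by `p.1` and, if `p.2` is
nontrivial, interchanges the sheets. -/
def coverAut (p : A × Multiplicative (ZMod 2)) :
    (mulCayley S).bipartiteDoubleCover ≃g (mulCayley S).bipartiteDoubleCover where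
  toEquiv := Function.Involutive.toPerm
    (fun z => (if p.2 = 1 then id else Sum.swap) (Sum.map (p.1 * ·) (p.1 * ·) z)) (by
      rintro (x | x) <;> by_cases h : p.2 = 1 <;> simp [h, mul_self_mul hA])
  map_rel_iff' := by
    rintro (x | x) (y | y) <;> by_cases h : p.2 = 1 <;>
      simp [h, cayley_adj hA h1, mul_mul_mul_comm p.1 _ p.1, hA]

theorem coverAut_apply (p : A × Multiplicative (ZMod 2)) (z : A ⊕ A) :
    coverAut hA h1 p z =
      (if p.2 = 1 then id else Sum.swap) (Sum.map (p.1 * ·) (p.1 * ·) z) := rfl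

theorem coverAut_one (a : A) (z : A ⊕ A) :
    coverAut hA h1 (a, 1) z = Sum.map (a * ·) (a * ·) z := by
  rw [coverAut_apply, if_pos rfl, id]

theorem coverAut_swap (a : A) (z : A ⊕ A) :
    coverAut hA h1 (a, Multiplicative.ofAdd 1) z = (Sum.map (a * ·) (a * ·) z).swap := by
  have h0 : (Multiplicative.ofAdd (1 : ZMod 2)) ≠ 1 := by decide
  rw [coverAut_apply, if_neg h0]

/-- The action of `A × ℤ₂` on the canonical double cover. -/
def coverHom : A × Multiplicative (ZMod 2) →*
    ((mulCayley S).bipartiteDoubleCover ≃g (mulCayley S).bipartiteDoubleCover) where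
  toFun := coverAut hA h1
  map_one' := RelIso.ext fun z => by
    refine (coverAut_one hA h1 1 z).trans ?_
    rw [RelIso.coe_one]
    rcases z with x | x <;> simp
  map_mul' := by
    rintro ⟨a, ε⟩ ⟨b, δ⟩
    have h2 : (Multiplicative.ofAdd (1 : ZMod 2)) * Multiplicative.ofAdd 1 = 1 := by decide
    refine RelIso.ext fun z => ?_
    rw [RelIso.coe_mul, Function.comp_apply, Prod.mk_mul_mk]
    rcases multiplicative_zmod_two ε with rfl | rfl <;>
      rcases multiplicative_zmod_two δ with rfl | rfl <;>
      simp only [mul_one, one_mul, h2, coverAut_one, coverAut_swap] <;>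
      rcases z with x | x <;> simp [mul_assoc]

theorem coverHom_one_inl (a x : A) :
    coverHom hA h1 (a, 1) (Sum.inl x) = Sum.inl (a * x) :=
  coverAut_one hA h1 a _

theorem coverHom_one_inr (a x : A) :
    coverHom hA h1 (a, 1) (Sum.inr x) = Sum.inr (a * x) :=
  coverAut_one hA h1 a _

theorem coverHom_swap_inl (a x : A) :
    coverHom hA h1 (a, Multiplicative.ofAdd 1) (Sum.inl x) = Sum.inr (a * x) :=
  coverAut_swap hA h1 a _

theorem coverHom_swap_inr (a x : A) :
    coverHom hA h1 (a, Multiplicative.ofAdd 1) (Sum.inr x) = Sum.inl (a * x) :=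
  coverAut_swap hA h1 a _

end

/-- An automorphism of the double cover that fixes one sheet at one vertex fixes both sheets
setwise, hence is a two-fold automorphism, hence a translation. -/
theorem exists_coverHom_eq_of_inl (hA : ∀ x : A, x * x = 1) {S : Set A} (h1 : (1 : A) ∉ S)
    (hne : S.Nonempty) (hS : TFRigid S) (hg : PairGenerates S)
    (f : (mulCayley S).bipartiteDoubleCover ≃g (mulCayley S).bipartiteDoubleCover)
    {b : A} (hf : f (Sum.inl 1) = Sum.inl b) : ∃ p, coverHom hA h1 p = f := by
  have step : ∀ x s, s ∈ S → (∃ y, f (Sum.inl x) = Sum.inl y) →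
      ∃ y, f (Sum.inr (x * s)) = Sum.inr y := by
    rintro x s hs ⟨y, hy⟩
    have : (mulCayley S).bipartiteDoubleCover.Adj (Sum.inl x) (Sum.inr (x * s)) := by
      simp [cayley_adj hA h1, mul_self_mul hA, hs]
    rw [← f.map_rel_iff, hy] at this
    rcases h : f (Sum.inr (x * s)) with z | z
    · rw [h] at this; simp at this
    · exact ⟨z, rfl⟩
  have step' : ∀ x s, s ∈ S → (∃ y, f (Sum.inr x) = Sum.inr y) →
      ∃ y, f (Sum.inl (x * s)) = Sum.inl y := by
    rintro x s hs ⟨y, hy⟩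
    have : (mulCayley S).bipartiteDoubleCover.Adj (Sum.inr x) (Sum.inl (x * s)) := by
      simp [cayley_adj hA h1, mul_self_mul hA, hs]
    rw [← f.map_rel_iff, hy] at this
    rcases h : f (Sum.inl (x * s)) with z | z
    · exact ⟨z, rfl⟩
    · rw [h] at this; simp at this
  have hl : ∀ x, ∃ y, f (Sum.inl x) = Sum.inl y := by
    refine hg _ ⟨b, hf⟩ fun x hx s hs t ht => ?_
    rw [← mul_assoc]
    exact step' _ t ht (step x s hs hx)
  have hr : ∀ x, ∃ y, f (Sum.inr x) = Sum.inr y := by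
    obtain ⟨s, hs⟩ := hne
    intro x
    have := step (x * s) s hs (hl _)
    rwa [mul_assoc, hA, mul_one] at this
  choose π₁ hπ₁ using hl
  choose π₂ hπ₂ using hr
  have b₁ : Function.Bijective π₁ := by
    constructor
    · intro x y h
      have := hπ₁ x
      rw [h, ← hπ₁ y] at this
      exact Sum.inl_injective (f.injective this)
    · intro y
      obtain ⟨z | z, hz⟩ := f.surjective (Sum.inl y)
      · exact ⟨z, Sum.inl_injective ((hπ₁ z).symm.trans hz)⟩
      · rw [hπ₂] at hz; cases hz
  have b₂ : Function.Bijective π₂ := by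
    constructor
    · intro x y h
      have := hπ₂ x
      rw [h, ← hπ₂ y] at this
      exact Sum.inr_injective (f.injective this)
    · intro y
      obtain ⟨z | z, hz⟩ := f.surjective (Sum.inr y)
      · rw [hπ₁] at hz; cases hz
      · exact ⟨z, Sum.inr_injective ((hπ₂ z).symm.trans hz)⟩
  obtain ⟨a, ha, hb⟩ := hS (Equiv.ofBijective π₁ b₁) (Equiv.ofBijective π₂ b₂) (by
    intro x y
    have := f.map_rel_iff (a := Sum.inl x) (b := Sum.inr y)
    rw [hπ₁, hπ₂] at this
    simpa [cayley_adj hA h1] using this.symm)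
  refine ⟨(a, 1), ?_⟩
  ext (x | x)
  · rw [coverHom_one_inl, hπ₁]; exact congrArg _ (ha x).symm
  · rw [coverHom_one_inr, hπ₂]; exact congrArg _ (hb x).symm

theorem TFRigid.coverHom_bijective (hA : ∀ x : A, x * x = 1) {S : Set A} (h1 : (1 : A) ∉ S)
    (hne : S.Nonempty) (hS : TFRigid S) (hg : PairGenerates S) :
    Function.Bijective (coverHom hA h1) := by
  constructor
  · rw [injective_iff_map_eq_one]
    rintro ⟨a, ε⟩ h
    have := DFunLike.congr_fun h (Sum.inl 1)
    rcases multiplicative_zmod_two ε with rfl | rfl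
    · rw [coverHom_one_inl] at this
      have h' : a * 1 = 1 := Sum.inl_injective this
      rw [mul_one] at h'
      rw [h']; rfl
    · rw [coverHom_swap_inl] at this
      cases this
  · intro f
    rcases h : f (Sum.inl 1) with b | b
    · exact exists_coverHom_eq_of_inl hA h1 hne hS hg f h
    · obtain ⟨p, hp⟩ := exists_coverHom_eq_of_inl hA h1 hne hS hg
        (coverHom hA h1 (1, Multiplicative.ofAdd 1) * f) (b := b) (by
          rw [RelIso.coe_mul, Function.comp_apply, h, coverHom_swap_inr, one_mul])
      refine ⟨(1, Multiplicative.ofAdd 1)⁻¹ * p, ?_⟩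
      rw [map_mul, map_inv, hp, inv_mul_cancel_left]

theorem TFRigid.isStable (hA : ∀ x : A, x * x = 1) {S : Set A} (h1 : (1 : A) ∉ S)
    (hne : S.Nonempty) (hS : TFRigid S) (hg : PairGenerates S) : IsStable (mulCayley S) :=
  ⟨(MulEquiv.ofBijective _ (hS.coverHom_bijective hA h1 hne hg)).symm.trans
    ((MulEquiv.ofBijective _ (hS.translation_bijective hA h1)).prodCongr (MulEquiv.refl _))⟩

section

variable (hA : ∀ x : A, x * x = 1)
include hA

theorem tfIsomorphic_shift {S : Set A} (h1 : (1 : A) ∉ S) {a : A} (ha : a ∉ S) :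
    TFIsomorphic (mulCayley S) (mulCayley (shiftSet S a)) := by
  refine ⟨Equiv.refl A, Equiv.mulLeft a, fun x y => ?_⟩
  have h1' : (1 : A) ∉ shiftSet S a := by simpa [shiftSet] using ha
  rw [cayley_adj hA h1, cayley_adj hA h1']
  simp [shiftSet, mul_left_comm x a y, mul_self_mul hA]

/-- If `(π₁, π₂)` is a two-fold isomorphism from a rigid Cayley graph to `G`, then, `G` being
undirected, `(π₂⁻¹ π₁, π₁⁻¹ π₂)` is a two-fold automorphism. So `π₁` and `π₂` differ by a
translation by some `a`, and `π₁` is an isomorphism from the Cayley graph of the shifted set. -/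
theorem TFRigid.exists_iso_shift {S : Set A} (hS : TFRigid S) (h1 : (1 : A) ∉ S) {W : Type*}
    {G : SimpleGraph W} (h : TFIsomorphic (mulCayley S) G) :
    ∃ a ∉ S, Nonempty (G ≃g mulCayley (shiftSet S a)) := by
  obtain ⟨π₁, π₂, h⟩ := h
  simp only [cayley_adj hA h1] at h
  obtain ⟨a, ha, -⟩ := hS (π₁.trans π₂.symm) (π₂.trans π₁.symm) (by
    intro x y
    rw [h, G.adj_comm, mul_comm]
    simp [h])
  have hπ : ∀ x, π₁ x = π₂ (a * x) := fun x => by rw [← ha x]; simp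
  have hadj : ∀ x y, G.Adj (π₁ x) (π₁ y) ↔ a * (x * y) ∈ S := fun x y => by
    rw [hπ y, ← h, mul_left_comm]
  have haS : a ∉ S := fun h' => G.irrefl ((hadj 1 1).2 (by simpa using h'))
  refine ⟨a, haS, ⟨RelIso.symm { toEquiv := π₁, map_rel_iff' := ?_ }⟩⟩
  intro x y
  have h1' : (1 : A) ∉ shiftSet S a := by simpa [shiftSet] using haS
  rw [hadj, cayley_adj hA h1']; rfl

theorem TFRigid.shift_iso_unique {S : Set A} (hS : TFRigid S) {a b : A} (ha : a ∉ S) (hb : b ∉ S)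
    (h : Nonempty (mulCayley (shiftSet S a) ≃g mulCayley (shiftSet S b))) : a = b := by
  obtain ⟨φ⟩ := h
  have ha' : (1 : A) ∉ shiftSet S a := by simpa [shiftSet] using ha
  have hb' : (1 : A) ∉ shiftSet S b := by simpa [shiftSet] using hb
  have hφ : ∀ x y, a * (x * y) ∈ S ↔ b * (φ x * φ y) ∈ S := fun x y => by
    have := φ.map_rel_iff (a := x) (b := y)
    rw [cayley_adj hA ha', cayley_adj hA hb'] at this
    exact this.symm
  obtain ⟨c, h₁, h₂⟩ := hS φ.toEquiv
    (((Equiv.mulLeft a).trans φ.toEquiv).trans (Equiv.mulLeft b)) (by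
      intro x y
      have := hφ x (a * y)
      rw [mul_left_comm x, mul_self_mul hA] at this
      rw [this, mul_left_comm]
      rfl)
  have e₁ := h₂ 1
  have e₂ := h₁ a
  simp only [Equiv.trans_apply, Equiv.coe_mulLeft, mul_one] at e₁
  rw [e₂, mul_comm c a, ← mul_assoc] at e₁
  have e₃ : b * a = 1 := by simpa using e₁
  rw [← mul_self_mul hA b a, e₃, mul_one]

end

end TwoFold

/-! ### Linked pairs -/

namespace TwoFold

open SimpleGraph

variable {A : Type*} [CommGroup A]

/-- `s` and `t` are linked if `s * t` has a second factorization in `S`, that is, if the vertices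
`s` and `t` have a common neighbour other than `1` and `s * t`. -/
def Linked (S : Set A) (s t : A) : Prop :=
  ∃ u ∈ S, ∃ w ∈ S, u * w = s * t ∧ u ≠ s ∧ u ≠ t

/-- Two-fold automorphisms preserve the number of common neighbours, hence the linked pairs. -/
theorem Linked.map (hA : ∀ x : A, x * x = 1) {S : Set A} {π₁ π₂ : A ≃ A}
    (h : ∀ x y, x * y ∈ S ↔ π₁ x * π₂ y ∈ S) (x : A) {s t : A} (hs : s ∈ S) (ht : t ∈ S)
    (hst : s ≠ t) (hl : Linked S s t) :
    Linked S (π₁ x * π₂ (x * s)) (π₁ x * π₂ (x * t)) := by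
  obtain ⟨u, hu, w, hw, huw, hus, hut⟩ := hl
  -- `y` ranges over the common neighbours of `x * s` and `x * t` other than `x`
  have key : ∀ y, y ≠ x → y * (x * s) ∈ S → y * (x * t) ∈ S →
      π₁ y ≠ π₁ x * (π₂ (x * s) * π₂ (x * t)) →
      Linked S (π₁ x * π₂ (x * s)) (π₁ x * π₂ (x * t)) := by
    intro y hyx hys hyt hy
    refine ⟨π₁ y * π₂ (x * s), (h _ _).1 hys, π₁ y * π₂ (x * t), (h _ _).1 hyt, ?_, ?_, ?_⟩
    · rw [mul_mul_mul_comm, mul_mul_mul_comm (π₁ x), hA, hA]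
    · exact fun e => hyx (π₁.injective (mul_right_cancel e))
    · intro e
      apply hy
      rw [mul_left_comm, ← e, mul_comm (π₁ y), mul_self_mul hA]
  have mem : ∀ a b, x * (s * a) * (x * b) = a * (s * b) := fun a b => by
    rw [mul_mul_mul_comm, hA, one_mul, mul_comm s a, mul_assoc]
  have c₁ : x * (s * u) * (x * s) = u := by rw [mem, hA, mul_one]
  have c₂ : x * (s * u) * (x * t) = w := by
    rw [mem, ← huw, mul_self_mul hA]
  have c₃ : x * (s * t) * (x * s) = t := by rw [mem, hA, mul_one]
  have c₄ : x * (s * t) * (x * t) = s := by rw [mem, mul_left_comm, hA, mul_one]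
  -- of two distinct such neighbours, at least one avoids the excluded value
  by_cases e : π₁ (x * (s * u)) = π₁ x * (π₂ (x * s) * π₂ (x * t))
  · refine key (x * (s * t)) (fun e' => hst ?_) (by rwa [c₃]) (by rwa [c₄]) fun e' => hut ?_
    · have : s * t = 1 := by simpa using e'
      rw [← mul_self_mul hA s t, this, mul_one]
    · have := π₁.injective (e.trans e'.symm)
      simpa using this
  · refine key (x * (s * u)) (fun e' => hus ?_) (by rwa [c₁]) (by rwa [c₂]) e
    have : s * u = 1 := by simpa using e'
    rw [← mul_self_mul hA s u, this, mul_one]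

/-- If no nontrivial permutation of `S` preserves the linked pairs, then a two-fold automorphism
acts on the neighbours of every vertex as a translation does; as `S * S` generates the group, it is
a translation. -/
theorem tfRigid_of_linked (hA : ∀ x : A, x * x = 1) {S : Set A} (hne : S.Nonempty)
    (hg : PairGenerates S)
    (hR : ∀ σ : S ≃ S, (∀ s t : S, s ≠ t → (Linked S s t ↔ Linked S (σ s) (σ t))) → ∀ s, σ s = s) :
    TFRigid S := by
  intro π₁ π₂ h
  have h' : ∀ x y, x * y ∈ S ↔ π₁.symm x * π₂.symm y ∈ S := fun x y => by
    rw [h (π₁.symm x), Equiv.apply_symm_apply, Equiv.apply_symm_apply]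
  have loc : ∀ x, ∀ s ∈ S, π₂ (x * s) = π₁ x * s := by
    intro x s hs
    let σ : S ≃ S :=
      { toFun := fun s => ⟨π₁ x * π₂ (x * s), (h _ _).1 (by rw [mul_self_mul hA]; exact s.2)⟩
        invFun := fun s => ⟨x * π₂.symm (π₁ x * s), (h _ _).2 (by
          rw [Equiv.apply_symm_apply, mul_self_mul hA]; exact s.2)⟩
        left_inv := fun s => Subtype.ext (by
          simp [mul_self_mul hA])
        right_inv := fun s => Subtype.ext (by
          simp [mul_self_mul hA]) }
    have := hR σ (by
      intro s t hst
      refine ⟨Linked.map hA h x s.2 t.2 (fun e => hst (Subtype.ext e)), fun hl => ?_⟩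
      have := Linked.map hA h' (π₁ x) (σ s).2 (σ t).2
        (fun e => hst (σ.injective (Subtype.ext e))) hl
      simpa [σ, mul_self_mul hA] using this) ⟨s, hs⟩
    have e : π₁ x * π₂ (x * s) = s := congrArg Subtype.val this
    rw [← mul_self_mul hA (π₁ x) (π₂ _), e]
  have h₁ : ∀ x, π₁ x = π₁ 1 * x := by
    refine hg _ (mul_one _).symm fun x hx s hs t ht => ?_
    have e := loc (x * (s * t)) t ht
    rw [mul_assoc, mul_assoc s, hA, mul_one, loc x s hs, hx] at e
    rw [← mul_one (π₁ _), ← hA t, ← mul_assoc (π₁ _), ← e]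
    simp only [mul_assoc, hA]
  obtain ⟨s, hs⟩ := hne
  refine ⟨π₁ 1, h₁, fun x => ?_⟩
  have e := loc (x * s) s hs
  rwa [mul_assoc, hA, mul_one, h₁, mul_assoc, mul_assoc, hA, mul_one] at e

end TwoFold

/-! ### Sparse triple systems -/

namespace TwoFold

open SimpleGraph

open scoped symmDiff

section

variable {P J : Type*} [DecidableEq P]

theorem card_symmDiff_add (X Y : Finset P) : (X ∆ Y).card + 2 * (X ∩ Y).card = X.card + Y.card := by
  have h₁ := Finset.card_sdiff_add_card_inter X Y
  have h₂ := Finset.card_sdiff_add_card_inter Y X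
  have h₃ : (X ∆ Y).card = (X \ Y).card + (Y \ X).card := by
    rw [symmDiff_def, Finset.sup_eq_union, Finset.card_union_of_disjoint]
    exact disjoint_sdiff_sdiff
  rw [Finset.inter_comm Y X] at h₂
  omega

/-- A system of triples is sparse if distinct triples share at most one point and no triple is the
sum (symmetric difference) of three others. Then the only sets of four singletons and triples with
sum zero are those consisting of a triple and its three points. -/
structure IsSparse (T : J → Finset P) : Prop where
  card_eq : ∀ j, (T j).card = 3
  inter_le : ∀ i j, i ≠ j → (T i ∩ T j).card ≤ 1
  sum_ne : ∀ i j l m, i ≠ j → l ≠ i → l ≠ j → T i ∆ T j ≠ T l ∆ T m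

/-- The sets of the extended system: the singletons of points, and the triples. -/
def cell (T : J → Finset P) : P ⊕ J → Finset P := Sum.elim (fun p => {p}) T

/-- `s` and `t` are linked if the symmetric difference of their cells is also that of another pair
of cells. -/
def CellLinked (T : J → Finset P) (s t : P ⊕ J) : Prop :=
  ∃ u w, cell T u ∆ cell T w = cell T s ∆ cell T t ∧ u ≠ s ∧ u ≠ t

theorem CellLinked.symm {T : J → Finset P} {s t : P ⊕ J} (h : CellLinked T s t) :
    CellLinked T t s := by
  obtain ⟨u, w, h, hs, ht⟩ := h
  exact ⟨u, w, h.trans (symmDiff_comm _ _), ht, hs⟩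

theorem card_singleton_symmDiff_le (p q : P) : (({p} : Finset P) ∆ {q}).card ≤ 2 := by
  have := card_symmDiff_add ({p} : Finset P) {q}
  simp only [Finset.card_singleton] at this
  omega

theorem symmDiff_exchange {a b c d : Finset P} (h : a ∆ b = c ∆ d) : a ∆ c = b ∆ d := by
  rw [← symmDiff_symmDiff_cancel_right b a, h]
  ext x
  simp only [Finset.mem_symmDiff]
  tauto

namespace IsSparse

variable {T : J → Finset P} (hT : IsSparse T)
include hT

theorem exists_eq {p : P} {j : J} (hp : p ∈ T j) :
    ∃ q r, p ≠ q ∧ p ≠ r ∧ q ≠ r ∧ T j = {p, q, r} := by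
  obtain ⟨x, y, z, hxy, hxz, hyz, h⟩ := Finset.card_eq_three.1 (hT.card_eq j)
  rw [h] at hp
  simp only [Finset.mem_insert, Finset.mem_singleton] at hp
  rcases hp with rfl | rfl | rfl
  · exact ⟨y, z, hxy, hxz, hyz, h⟩
  · exact ⟨x, z, hxy.symm, hyz, hxz, by rw [h, Finset.insert_comm]⟩
  · exact ⟨x, y, hxz.symm, hyz.symm, hxy, by rw [h]; ext; simp; tauto⟩

theorem injective : Function.Injective T := by
  intro i j h
  by_contra hij
  have := hT.inter_le i j hij
  rw [h, Finset.inter_self, hT.card_eq] at this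
  omega

theorem four_le {i j : J} (h : i ≠ j) : 4 ≤ (T i ∆ T j).card := by
  have h₁ := card_symmDiff_add (T i) (T j)
  have h₂ := hT.inter_le i j h
  rw [hT.card_eq, hT.card_eq] at h₁
  omega

theorem ne_singletons {i j : J} (h : i ≠ j) (p q : P) : T i ∆ T j ≠ {p} ∆ {q} := fun e => by
  have h₁ := hT.four_le h
  have h₂ := card_singleton_symmDiff_le p q
  rw [e] at h₁
  omega

theorem ne_singleton_left (i : J) (p : P) : T i ≠ {p} := fun e => by
  have h := hT.card_eq i
  rw [e, Finset.card_singleton] at h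
  omega

/-- Three triples, two of them distinct, do not sum to a singleton: three pairwise distinct triples
sum to a set of at least `9 - 2 * 3` points. -/
theorem ne_singleton {i j : J} (hij : i ≠ j) (p : P) (l : J) : T i ∆ T j ≠ {p} ∆ T l := by
  intro e
  rcases eq_or_ne j l with rfl | hjl
  · exact hT.ne_singleton_left i p (symmDiff_left_injective _ e)
  rcases eq_or_ne i l with rfl | hil
  · rw [symmDiff_comm] at e
    exact hT.ne_singleton_left j p (symmDiff_left_injective _ e)
  have h₁ := card_symmDiff_add (T i ∆ T j) (T l)
  have h₂ := hT.four_le hij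
  have h₃ : ((T i ∆ T j) ∩ T l).card ≤ (T i ∩ T l).card + (T j ∩ T l).card := by
    refine (Finset.card_le_card ?_).trans (Finset.card_union_le _ _)
    intro x
    simp only [Finset.mem_inter, Finset.mem_union, Finset.mem_symmDiff]
    tauto
  have h₄ := hT.inter_le i l hil
  have h₅ := hT.inter_le j l hjl
  rw [hT.card_eq l] at h₁
  have h₆ : ((T i ∆ T j) ∆ T l).card = 1 := by
    rw [e, symmDiff_symmDiff_cancel_right, Finset.card_singleton]
  omega

theorem cellLinked_inl_inl {p q : P} (hpq : p ≠ q) :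
    CellLinked T (Sum.inl p) (Sum.inl q) ↔ ∃ j, p ∈ T j ∧ q ∈ T j := by
  constructor
  · have key : ∀ (r : P) (j : J), {r} ∆ T j = {p} ∆ {q} → ∃ j, p ∈ T j ∧ q ∈ T j := by
      intro r j e
      have hrp : r ≠ p := by
        rintro rfl
        exact hT.ne_singleton_left j q (symmDiff_right_injective _ e)
      have hrq : r ≠ q := by
        rintro rfl
        exact hT.ne_singleton_left j p
          (symmDiff_right_injective _ (e.trans (symmDiff_comm _ _)))
      have h₁ := Finset.ext_iff.1 e p
      have h₂ := Finset.ext_iff.1 e q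
      simp only [Finset.mem_symmDiff, Finset.mem_singleton] at h₁ h₂
      exact ⟨j, by grind, by grind⟩
    rintro ⟨u | u, w | w, e, hs, ht⟩
    · have h₁ := Finset.ext_iff.1 e u
      have h₂ := Finset.ext_iff.1 e p
      simp only [cell, Sum.elim_inl, Finset.mem_symmDiff, Finset.mem_singleton] at h₁ h₂
      grind
    · exact key u w e
    · exact key w u ((symmDiff_comm _ _).trans e)
    · rcases eq_or_ne u w with rfl | h
      · have h₂ := Finset.ext_iff.1 e p
        simp [cell, Finset.mem_symmDiff, hpq] at h₂
      · exact absurd e (hT.ne_singletons h p q)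
  · rintro ⟨j, hp, hq⟩
    obtain ⟨x, y, hx, hy, hxy, e⟩ := hT.exists_eq hp
    rw [e] at hq
    have key : ∀ r, p ≠ r → q ≠ r → T j = {p, q, r} → CellLinked T (Sum.inl p) (Sum.inl q) := by
      intro r hpr hqr e
      refine ⟨Sum.inl r, Sum.inr j, ?_, by simpa using hpr.symm, by simpa using hqr.symm⟩
      ext z
      simp only [cell, Sum.elim_inl, Sum.elim_inr, e, Finset.mem_symmDiff, Finset.mem_singleton,
        Finset.mem_insert]
      grind
    simp only [Finset.mem_insert, Finset.mem_singleton] at hq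
    rcases hq with rfl | rfl | rfl
    · exact absurd rfl hpq
    · exact key y hy hxy e
    · exact key x hx hxy.symm (by rw [e, Finset.pair_comm])

theorem cellLinked_inl_inr {p : P} {j : J} :
    CellLinked T (Sum.inl p) (Sum.inr j) ↔ p ∈ T j := by
  constructor
  · rintro ⟨u | u, w | w, e, hs, ht⟩
    · have e' : {u} ∆ {w} = {p} ∆ T j := e
      by_contra hp
      have h₁ := card_symmDiff_add {p} (T j)
      have h₂ := card_singleton_symmDiff_le u w
      rw [Finset.singleton_inter_of_notMem hp, hT.card_eq, ← e'] at h₁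
      simp at h₁
      omega
    · have e' : {u} ∆ T w = {p} ∆ T j := e
      rcases eq_or_ne w j with rfl | h
      · have := symmDiff_left_injective _ e'
        simp only [Finset.singleton_inj] at this
        exact absurd (by rw [this]) hs
      · exact absurd (symmDiff_exchange e').symm (hT.ne_singletons h u p)
    · have e' : T u ∆ {w} = {p} ∆ T j := e
      have h : u ≠ j := by simpa using ht
      replace e' := e'.trans (symmDiff_comm _ _)
      exact absurd (symmDiff_exchange e') (hT.ne_singletons h w p)
    · have e' : T u ∆ T w = {p} ∆ T j := e
      have h : u ≠ j := by simpa using ht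
      rcases eq_or_ne u w with rfl | h'
      · rw [symmDiff_self] at e'
        have := symmDiff_eq_bot.1 e'.symm
        have h'' := hT.card_eq j
        rw [← this] at h''
        simp at h''
      · exact absurd e' (hT.ne_singleton h' p j)
  · intro hp
    obtain ⟨q, r, hq, hr, hqr, e⟩ := hT.exists_eq hp
    refine ⟨Sum.inl q, Sum.inl r, ?_, by simpa using hq.symm, by simp⟩
    ext z
    simp only [cell, Sum.elim_inl, Sum.elim_inr, e, Finset.mem_symmDiff, Finset.mem_singleton,
      Finset.mem_insert]
    grind

theorem not_cellLinked_inr_inr {i j : J} (hij : i ≠ j) :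
    ¬ CellLinked T (Sum.inr i) (Sum.inr j) := by
  rintro ⟨u | u, w | w, e, hs, ht⟩
  · exact hT.ne_singletons hij u w (Eq.symm e)
  · exact hT.ne_singleton hij u w (Eq.symm e)
  · exact hT.ne_singleton hij w u (Eq.symm ((symmDiff_comm _ _).trans e))
  · exact hT.sum_ne i j u w hij (by simpa using hs) (by simpa using ht) (Eq.symm e)

/-- If every point lies on two triples, a permutation preserving the linked pairs maps points to
points, because the neighbourhood of a triple is a clique and that of a point is not. So
it comes from an automorphism of the triple system. -/
theorem eq_of_cellLinked [Finite P] [Finite J] (hdeg : ∀ p, ∃ i j, i ≠ j ∧ p ∈ T i ∧ p ∈ T j)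
    (hasym : ∀ (τ : Equiv.Perm P) (θ : Equiv.Perm J),
      (∀ p j, p ∈ T j ↔ τ p ∈ T (θ j)) → ∀ p, τ p = p)
    (σ : Equiv.Perm (P ⊕ J))
    (hσ : ∀ s t, s ≠ t → (CellLinked T s t ↔ CellLinked T (σ s) (σ t))) (s : P ⊕ J) :
    σ s = s := by
  have nadj : ∀ m s, σ s ≠ Sum.inr m → CellLinked T (Sum.inr m) (σ s) →
      ∃ a, σ s = Sum.inl a ∧ a ∈ T m := by
    intro m s hne h
    rcases hs : σ s with a | a
    · rw [hs] at h
      exact ⟨a, rfl, hT.cellLinked_inl_inr.1 h.symm⟩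
    · rw [hs] at h hne
      exact absurd h (hT.not_cellLinked_inr_inr (by simpa using hne.symm))
  have hmaps : Set.MapsTo σ (Set.range Sum.inl) (Set.range Sum.inl) := by
    rintro _ ⟨p, rfl⟩
    rcases hp : σ (Sum.inl p) with a | m
    · exact ⟨a, rfl⟩
    exfalso
    obtain ⟨i, j, hij, hi, hj⟩ := hdeg p
    have step : ∀ i, p ∈ T i → ∃ a, σ (Sum.inr i) = Sum.inl a ∧ a ∈ T m := by
      intro i hi
      refine nadj m _ (fun e => ?_) ?_
      · have := σ.injective (e.trans hp.symm)
        cases this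
      · rw [← hp, ← hσ _ _ (by simp)]
        exact hT.cellLinked_inl_inr.2 hi
    obtain ⟨a, ha, ham⟩ := step i hi
    obtain ⟨b, hb, hbm⟩ := step j hj
    have hab : a ≠ b := by
      rintro rfl
      have := σ.injective (ha.trans hb.symm)
      exact hij (by simpa using this)
    refine hT.not_cellLinked_inr_inr hij ?_
    rw [hσ _ _ (by simpa using hij), ha, hb, hT.cellLinked_inl_inl hab]
    exact ⟨m, ham, hbm⟩
  obtain ⟨⟨τ, θ⟩, rfl⟩ := Equiv.Perm.mem_sumCongrHom_range_of_perm_mapsTo_inl hmaps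
  have hinc : ∀ p j, p ∈ T j ↔ τ p ∈ T (θ j) := by
    intro p j
    have := hσ (Sum.inl p) (Sum.inr j) (by simp)
    rw [hT.cellLinked_inl_inr] at this
    rw [this]
    exact hT.cellLinked_inl_inr
  have hτ := hasym τ θ hinc
  rcases s with p | j
  · exact congrArg Sum.inl (hτ p)
  · refine congrArg Sum.inr (hT.injective ?_)
    ext p
    rw [hinc p j, hτ]

end IsSparse

end

end TwoFold

/-! ### The connection set of a triple system -/

namespace TwoFold

open SimpleGraph

open scoped symmDiff

theorem z2Pow_mul_self {k : ℕ} (x : Z2Pow k) : x * x = 1 := by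
  refine Multiplicative.toAdd.injective (funext fun i => ?_)
  exact CharTwo.add_self_eq_zero _

section

variable {k : ℕ} {J : Type*} (T : J → Finset (Fin (k + 1)))

/-- The element of `ℤ₂ ^ k` of a cell: the complement of its indicator vector, with the last
coordinate dropped. Complementing does not change products of two such elements, and it keeps the
identity out of the connection set. -/
def cellVec (s : Fin (k + 1) ⊕ J) : Z2Pow k :=
  Multiplicative.ofAdd fun i => 1 + if i.castSucc ∈ cell T s then 1 else 0

/-- The connection set of a triple system on `k + 1` points. -/
def connSet : Set (Z2Pow k) := Set.range (cellVec T)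

theorem pairGenerates_connSet : PairGenerates (connSet T) := by
  intro Q h1 hQ x
  have single : ∀ x (i : Fin k) (c : ZMod 2), Q x →
      Q (x * Multiplicative.ofAdd (Pi.single i c)) := by
    intro x i c hx
    have hc : c = 0 ∨ c = 1 := by revert c; decide
    rcases hc with rfl | rfl
    · simpa using hx
    · have := hQ x hx _ ⟨Sum.inl i.castSucc, rfl⟩ _ ⟨Sum.inl (Fin.last k), rfl⟩
      convert this using 2
      refine Multiplicative.toAdd.injective (funext fun j => ?_)
      rcases eq_or_ne j i with rfl | h
      · simp [cellVec, cell, Fin.castSucc_ne_last]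
        decide
      · simp [cellVec, cell, Fin.castSucc_ne_last, h, CharTwo.add_self_eq_zero]
  have sum : ∀ s : Finset (Fin k),
      Q (Multiplicative.ofAdd (∑ i ∈ s, Pi.single i (x.toAdd i))) := by
    intro s
    induction s using Finset.induction_on with
    | empty => simpa using h1
    | insert i s hi ih =>
      rw [Finset.sum_insert hi, add_comm, ofAdd_add]
      exact single _ _ _ ih
  have := sum Finset.univ
  rwa [Finset.univ_sum_single] at this

variable {T} (hT : IsSparse T)
include hT

theorem cell_card (s : Fin (k + 1) ⊕ J) : (cell T s).card = 1 ∨ (cell T s).card = 3 := by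
  rcases s with p | j
  · exact Or.inl (Finset.card_singleton _)
  · exact Or.inr (hT.card_eq j)

theorem cell_injective : Function.Injective (cell T) := by
  rintro (p | i) (q | j) h
  · exact congrArg Sum.inl (Finset.singleton_injective h)
  · exact absurd h.symm (hT.ne_singleton_left j p)
  · exact absurd h (hT.ne_singleton_left i q)
  · exact congrArg Sum.inr (hT.injective h)

/-- Equal products of two correspond to equal symmetric differences of cells: the dropped
coordinate is determined by parity, as all cells have odd size. -/
theorem cellVec_mul_eq_iff (s t u w : Fin (k + 1) ⊕ J) :
    cellVec T s * cellVec T t = cellVec T u * cellVec T w ↔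
      cell T s ∆ cell T t = cell T u ∆ cell T w := by
  have coord : cellVec T s * cellVec T t = cellVec T u * cellVec T w ↔
      ∀ i : Fin k, i.castSucc ∈ cell T s ∆ cell T t ↔ i.castSucc ∈ cell T u ∆ cell T w := by
    rw [← Multiplicative.toAdd.injective.eq_iff, funext_iff]
    refine forall_congr' fun i => ?_
    simp only [cellVec, toAdd_mul, toAdd_ofAdd, Pi.add_apply, Finset.mem_symmDiff]
    by_cases h₁ : i.castSucc ∈ cell T s <;> by_cases h₂ : i.castSucc ∈ cell T t <;>
      by_cases h₃ : i.castSucc ∈ cell T u <;> by_cases h₄ : i.castSucc ∈ cell T w <;>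
      simp only [h₁, h₂, h₃, h₄, if_true, if_false] <;> decide
  rw [coord]
  refine ⟨fun h => ?_, fun h i => by rw [h]⟩
  have hD : (cell T s ∆ cell T t) ∆ (cell T u ∆ cell T w) ⊆ {Fin.last k} := by
    intro p hp
    rw [Finset.mem_singleton]
    by_contra hne
    obtain ⟨i, rfl⟩ := Fin.exists_castSucc_eq.2 hne
    have := h i
    rw [Finset.mem_symmDiff] at hp
    tauto
  have c₁ := card_symmDiff_add (cell T s) (cell T t)
  have c₂ := card_symmDiff_add (cell T u) (cell T w)
  have c₃ := card_symmDiff_add (cell T s ∆ cell T t) (cell T u ∆ cell T w)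
  have c₄ := Finset.card_le_card hD
  rw [Finset.card_singleton] at c₄
  have c₅ : ((cell T s ∆ cell T t) ∆ (cell T u ∆ cell T w)).card = 0 := by
    rcases cell_card hT s, cell_card hT t, cell_card hT u, cell_card hT w with
      ⟨h₁ | h₁, h₂ | h₂, h₃ | h₃, h₄ | h₄⟩ <;> omega
  exact symmDiff_eq_bot.1 (Finset.card_eq_zero.1 c₅)

theorem cellVec_injective : Function.Injective (cellVec T) := by
  intro s t h
  have h' : cellVec T s * cellVec T s = cellVec T s * cellVec T t := by rw [← h]
  rw [cellVec_mul_eq_iff hT] at h'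
  exact cell_injective hT (symmDiff_right_injective _ h')

theorem one_notMem_connSet (hk : 4 ≤ k) : (1 : Z2Pow k) ∉ connSet T := by
  rintro ⟨s, hs⟩
  have hmem : ∀ i : Fin k, i.castSucc ∈ cell T s := by
    intro i
    by_contra h
    have := congrFun (congrArg Multiplicative.toAdd hs) i
    simp [cellVec, h] at this
  have : (Finset.univ.map (Fin.castSuccEmb (n := k))) ⊆ cell T s := by
    intro p hp
    obtain ⟨i, -, rfl⟩ := Finset.mem_map.1 hp
    exact hmem i
  have h₁ := Finset.card_le_card this
  rw [Finset.card_map, Finset.card_univ, Fintype.card_fin] at h₁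
  rcases cell_card hT s with h | h <;> omega

theorem ncard_connSet [Fintype J] (hJ : Fintype.card J = k + 1) :
    (connSet T).ncard = 2 * k + 2 := by
  rw [connSet, ← Nat.card_coe_set_eq, Nat.card_range_of_injective (cellVec_injective hT),
    Nat.card_eq_fintype_card, Fintype.card_sum, Fintype.card_fin, hJ]
  ring

theorem linked_connSet_iff (s t : Fin (k + 1) ⊕ J) :
    Linked (connSet T) (cellVec T s) (cellVec T t) ↔ CellLinked T s t := by
  constructor
  · rintro ⟨_, ⟨u, rfl⟩, _, ⟨w, rfl⟩, h, hs, ht⟩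
    exact ⟨u, w, (cellVec_mul_eq_iff hT _ _ _ _).1 h, fun e => hs (by rw [e]),
      fun e => ht (by rw [e])⟩
  · rintro ⟨u, w, h, hs, ht⟩
    exact ⟨_, ⟨u, rfl⟩, _, ⟨w, rfl⟩, (cellVec_mul_eq_iff hT _ _ _ _).2 h,
      (cellVec_injective hT).ne hs, (cellVec_injective hT).ne ht⟩

theorem tfRigid_connSet [Finite J] (hdeg : ∀ p, ∃ i j, i ≠ j ∧ p ∈ T i ∧ p ∈ T j)
    (hasym : ∀ (τ : Equiv.Perm (Fin (k + 1))) (θ : Equiv.Perm J),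
      (∀ p j, p ∈ T j ↔ τ p ∈ T (θ j)) → ∀ p, τ p = p) :
    TFRigid (connSet T) := by
  refine tfRigid_of_linked z2Pow_mul_self ⟨_, Sum.inl (Fin.last k), rfl⟩
    (pairGenerates_connSet T) fun σ hσ => ?_
  let e : Fin (k + 1) ⊕ J ≃ connSet T := Equiv.ofInjective _ (cellVec_injective hT)
  have key := hT.eq_of_cellLinked hdeg hasym ((e.trans σ).trans e.symm) (by
    intro s t hst
    have := hσ (e s) (e t) (e.injective.ne hst)
    rw [← linked_connSet_iff hT, ← linked_connSet_iff hT]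
    have he : ∀ s, cellVec T s = (e s : Z2Pow k) := fun s => rfl
    rw [he, he, he, he]
    simpa using this)
  intro s
  have := key (e.symm s)
  simpa using this

end

end TwoFold

/-! ### An asymmetric sparse triple system -/

namespace TwoFold

open SimpleGraph

open scoped symmDiff

/-- Incidence of the point `p` and the triple `j`, both numbered `0, …, k`. The triples
`{j, j + 1, j + 3}` with `j + 3 < k` form a chain on the points `0, …, k - 1`; the other four join
`k` to pairs of points close to the two ends of the chain. These pairs make every degree
at least two and leave no symmetry, and their points are too far apart to be connected by two
triples of the chain. -/
def Inc (k p j : ℕ) : Prop :=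
  (j + 3 < k ∧ (p = j ∨ p = j + 1 ∨ p = j + 3)) ∨
  (j + 3 = k ∧ (p = 0 ∨ p + 1 = k ∨ p = k)) ∨
  (j + 2 = k ∧ (p = 1 ∨ p + 2 = k ∨ p = k)) ∨
  (j + 1 = k ∧ (p = 2 ∨ p + 4 = k ∨ p = k)) ∨
  (j = k ∧ (p = 3 ∨ p + 3 = k ∨ p = k))

open Classical in
/-- The triple system with incidence relation `Inc k`. -/
noncomputable def triples (k : ℕ) (j : Fin (k + 1)) : Finset (Fin (k + 1)) :=
  Finset.univ.filter fun p => Inc k p j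

theorem mem_triples {k : ℕ} {p j : Fin (k + 1)} : p ∈ triples k j ↔ Inc k p j := by
  simp [triples]

theorem mem_iff_of_symmDiff_eq {P : Type*} [DecidableEq P] {X Y Z W : Finset P}
    (h : X ∆ Y = Z ∆ W) {p : P} : (p ∈ X ↔ p ∈ Y) ↔ (p ∈ Z ↔ p ∈ W) := by
  have := Finset.ext_iff.1 h p
  simp only [Finset.mem_symmDiff] at this
  tauto

section

variable {k : ℕ} (hk : 13 ≤ k)
include hk

theorem Inc.exists_points {j : ℕ} (hj : j ≤ k) :
    ∃ a b c, a < b ∧ b < c ∧ c ≤ k ∧ ∀ p, Inc k p j ↔ p = a ∨ p = b ∨ p = c := by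
  have hcases : j + 3 < k ∨ j + 3 = k ∨ j + 2 = k ∨ j + 1 = k ∨ j = k := by omega
  rcases hcases with h | h | h | h | h
  · exact ⟨j, j + 1, j + 3, by omega, by omega, by omega, fun p => by unfold Inc; omega⟩
  · exact ⟨0, k - 1, k, by omega, by omega, by omega, fun p => by unfold Inc; omega⟩
  · exact ⟨1, k - 2, k, by omega, by omega, by omega, fun p => by unfold Inc; omega⟩
  · exact ⟨2, k - 4, k, by omega, by omega, by omega, fun p => by unfold Inc; omega⟩
  · exact ⟨3, k - 3, k, by omega, by omega, by omega, fun p => by unfold Inc; omega⟩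

theorem Inc.unique {p q i j : ℕ} (hpq : p < q) (h₁ : Inc k p i) (h₂ : Inc k q i)
    (h₃ : Inc k p j) (h₄ : Inc k q j) : i = j := by
  unfold Inc at *
  omega

/-- In a set of four triples some point of some triple lies on no other one. Otherwise the set
contains two triples through `k` and, to cover the two further points of the first of these, one
triple of the chain close to each end; the one close to `0` has too many points. -/
theorem Inc.not_even_cover (I : Finset ℕ) (hI : I.card = 4) (hle : ∀ x ∈ I, x ≤ k)
    (hcov : ∀ x ∈ I, ∀ p, Inc k p x → ∃ y ∈ I, y ≠ x ∧ Inc k p y) : False := by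
  have hne : I.Nonempty := Finset.card_pos.1 (by omega)
  -- the largest index is that of a triple through the point `k`: otherwise its largest point is
  -- covered only once
  obtain ⟨x, hx, hxk⟩ : ∃ x ∈ I, k ≤ x + 3 := by
    by_contra! hlt
    obtain ⟨y, hy, hne, hinc⟩ := hcov _ (I.max'_mem hne) (I.max' hne + 3)
      (by have := hlt _ (I.max'_mem hne); unfold Inc; omega)
    have h₁ := I.le_max' y hy
    have h₂ := hlt y hy
    unfold Inc at hinc
    omega
  have hxle := hle x hx
  obtain ⟨y, hy, hyx, hy'⟩ := hcov x hx k (by unfold Inc; omega)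
  obtain ⟨z, hz, hzx, hz'⟩ := hcov x hx (x + 3 - k) (by unfold Inc; omega)
  have hzs : z ≤ 3 := by unfold Inc at hz'; omega
  obtain ⟨b, hb, hbk⟩ : ∃ b, Inc k b x ∧ k - 4 ≤ b ∧ b < k := by
    have hcases : x + 3 = k ∨ x + 2 = k ∨ x + 1 = k ∨ x = k := by omega
    rcases hcases with h | h | h | h
    · exact ⟨k - 1, by unfold Inc; omega, by omega⟩
    · exact ⟨k - 2, by unfold Inc; omega, by omega⟩
    · exact ⟨k - 4, by unfold Inc; omega, by omega⟩
    · exact ⟨k - 3, by unfold Inc; omega, by omega⟩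
  obtain ⟨w, hw, hwx, hw'⟩ := hcov x hx b hb
  have hwk : k - 7 ≤ w ∧ w + 3 < k := by
    unfold Inc at hw' hb
    omega
  have hyk : k ≤ y + 3 ∧ y ≤ k := by unfold Inc at hy'; omega
  have hI' : {x, y, z, w} = I := by
    refine Finset.eq_of_subset_of_card_le ?_ ?_
    · intro u
      simp only [Finset.mem_insert, Finset.mem_singleton]
      rintro (rfl | rfl | rfl | rfl) <;> assumption
    · rw [hI, Finset.card_insert_of_notMem, Finset.card_insert_of_notMem,
        Finset.card_insert_of_notMem, Finset.card_singleton] <;>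
      simp only [Finset.mem_insert, Finset.mem_singleton] <;> omega
  -- the three points of the triple `z` lie among the two small points of the triples `x` and `y`
  have cov : ∀ p, Inc k p z → p + k = x + 3 ∨ p + k = y + 3 := by
    intro p hp
    obtain ⟨u, hu, huz, hu'⟩ := hcov z hz p hp
    rw [← hI'] at hu
    simp only [Finset.mem_insert, Finset.mem_singleton] at hu
    have hp6 : p ≤ z + 3 := by unfold Inc at hp; omega
    rcases hu with rfl | rfl | rfl | rfl
    · left; unfold Inc at hu'; omega
    · right; unfold Inc at hu'; omega
    · exact absurd rfl huz
    · exfalso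
      unfold Inc at hu' hw' hb hz'
      omega
  have c₁ := cov z (by unfold Inc; omega)
  have c₂ := cov (z + 1) (by unfold Inc; omega)
  have c₃ := cov (z + 3) (by unfold Inc; omega)
  omega

theorem triples_injective : Function.Injective (triples k) := by
  intro x y hxy
  obtain ⟨a, b, c, hab, hbc, hc, h⟩ := Inc.exists_points hk (Nat.lt_succ_iff.1 x.2)
  have hmem : ∀ n (hn : n < k + 1), Inc k n x → Inc k n y := fun n hn hinc =>
    mem_triples.1 (hxy ▸ mem_triples.2 hinc : (⟨n, hn⟩ : Fin (k + 1)) ∈ triples k y)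
  have ha := (h a).2 (by simp)
  have hb := (h b).2 (by simp)
  exact Fin.ext (Inc.unique hk hab ha hb (hmem a (by omega) ha) (hmem b (by omega) hb))

theorem isSparse_triples : IsSparse (triples k) where
  card_eq j := by
    obtain ⟨a, b, c, hab, hbc, hc, h⟩ := Inc.exists_points hk (Nat.lt_succ_iff.1 j.2)
    rw [Finset.card_eq_three]
    refine ⟨⟨a, by omega⟩, ⟨b, by omega⟩, ⟨c, by omega⟩, ?_, ?_, ?_, ?_⟩
    · simp only [ne_eq, Fin.mk.injEq]; omega
    · simp only [ne_eq, Fin.mk.injEq]; omega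
    · simp only [ne_eq, Fin.mk.injEq]; omega
    · ext p
      simp only [mem_triples, h, Finset.mem_insert, Finset.mem_singleton, Fin.ext_iff]
  inter_le i j hij := by
    rw [Finset.card_le_one]
    intro p hp q hq
    simp only [Finset.mem_inter, mem_triples] at hp hq
    by_contra hpq
    rcases lt_or_gt_of_ne hpq with h | h
    · exact hij (Fin.ext (Inc.unique hk h hp.1 hq.1 hp.2 hq.2))
    · exact hij (Fin.ext (Inc.unique hk h hq.1 hp.1 hq.2 hp.2))
  sum_ne i j l m hij hli hlj h := by
    have hml : m ≠ l := by
      rintro rfl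
      rw [symmDiff_self] at h
      exact hij (triples_injective hk (symmDiff_eq_bot.1 h))
    have hmi : m ≠ i := by
      rintro rfl
      exact hlj (triples_injective hk (symmDiff_right_injective _
        (h.trans (symmDiff_comm _ _)))).symm
    have hmj : m ≠ j := by
      rintro rfl
      exact hli (triples_injective hk (symmDiff_left_injective _ h)).symm
    have heven := fun p => mem_iff_of_symmDiff_eq h (p := p)
    simp only [mem_triples] at heven
    rw [ne_eq, Fin.ext_iff] at hij hli hlj hml hmi hmj
    refine Inc.not_even_cover hk {(i : ℕ), (j : ℕ), (l : ℕ), (m : ℕ)} ?_ ?_ ?_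
    · rw [Finset.card_insert_of_notMem, Finset.card_insert_of_notMem,
        Finset.card_insert_of_notMem, Finset.card_singleton] <;>
      simp only [Finset.mem_insert, Finset.mem_singleton] <;> omega
    · intro x hx
      simp only [Finset.mem_insert, Finset.mem_singleton] at hx
      omega
    · intro x hx p hp
      simp only [Finset.mem_insert, Finset.mem_singleton] at hx
      have hpk : p ≤ k := by
        obtain ⟨a, b, c, hab, hbc, hc, h⟩ := Inc.exists_points hk (j := x) (by omega)
        have := (h p).1 hp
        omega
      have hev : (Inc k p i ↔ Inc k p j) ↔ (Inc k p l ↔ Inc k p m) := heven ⟨p, by omega⟩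
      have pick : ∀ y : ℕ, (y = i ∨ y = j ∨ y = l ∨ y = m) → y ≠ x → Inc k p y →
          ∃ y ∈ ({(i : ℕ), (j : ℕ), (l : ℕ), (m : ℕ)} : Finset ℕ), y ≠ x ∧ Inc k p y :=
        fun y hy hyx hinc => ⟨y, by simpa using hy, hyx, hinc⟩
      rcases hx with rfl | rfl | rfl | rfl
      · rcases (by clear * - hev hp; tauto : Inc k p j ∨ Inc k p l ∨ Inc k p m) with h | h | h <;>
          exact pick _ (by simp) (by omega) h
      · rcases (by clear * - hev hp; tauto : Inc k p i ∨ Inc k p l ∨ Inc k p m) with h | h | h <;>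
          exact pick _ (by simp) (by omega) h
      · rcases (by clear * - hev hp; tauto : Inc k p i ∨ Inc k p j ∨ Inc k p m) with h | h | h <;>
          exact pick _ (by simp) (by omega) h
      · rcases (by clear * - hev hp; tauto : Inc k p i ∨ Inc k p j ∨ Inc k p l) with h | h | h <;>
          exact pick _ (by simp) (by omega) h

theorem exists_three_triples {p : ℕ} (hp : p ≤ k) (h0 : p ≠ 0) (h1 : p + 1 ≠ k) (h2 : p + 2 ≠ k) :
    ∃ i j l, i < j ∧ j < l ∧ l ≤ k ∧ Inc k p i ∧ Inc k p j ∧ Inc k p l := by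
  have hcases : p = 1 ∨ p = 2 ∨ (3 ≤ p ∧ p + 3 < k) ∨ p + 3 = k ∨ p = k := by omega
  rcases hcases with h | h | h | h | h
  · refine ⟨0, 1, k - 2, ?_⟩; unfold Inc; omega
  · refine ⟨1, 2, k - 1, ?_⟩; unfold Inc; omega
  · refine ⟨p - 3, p - 1, p, ?_⟩; unfold Inc; omega
  · refine ⟨p - 3, p - 1, k, ?_⟩; unfold Inc; omega
  · refine ⟨k - 2, k - 1, k, ?_⟩; unfold Inc; omega

theorem Inc.not_three {p : ℕ} (hp : p = 0 ∨ p + 1 = k ∨ p + 2 = k) {i j l : ℕ} (hij : i ≠ j)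
    (hil : i ≠ l) (hjl : j ≠ l) (hi : Inc k p i) (hj : Inc k p j) (hl : Inc k p l) : False := by
  unfold Inc at *
  omega

theorem exists_two_triples (p : Fin (k + 1)) :
    ∃ i j, i ≠ j ∧ p ∈ triples k i ∧ p ∈ triples k j := by
  suffices h : ∃ i j, i < j ∧ j < k + 1 ∧ Inc k p i ∧ Inc k p j by
    obtain ⟨i, j, hij, hj, h₁, h₂⟩ := h
    refine ⟨⟨i, by omega⟩, ⟨j, hj⟩, ?_, mem_triples.2 h₁, mem_triples.2 h₂⟩
    simp only [ne_eq, Fin.mk.injEq]; omega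
  have hp := p.2
  by_cases h0 : (p : ℕ) = 0
  · refine ⟨0, k - 3, ?_⟩; unfold Inc; omega
  by_cases h1 : (p : ℕ) + 1 = k
  · refine ⟨k - 4, k - 3, ?_⟩; unfold Inc; omega
  by_cases h2 : (p : ℕ) + 2 = k
  · refine ⟨k - 5, k - 2, ?_⟩; unfold Inc; omega
  obtain ⟨i, j, l, hij, hjl, hl, h₁, h₂, -⟩ := exists_three_triples hk (by omega) h0 h1 h2
  exact ⟨i, j, hij, by omega, h₁, h₂⟩

/-- An automorphism of the triple system preserves the set `{0, k - 1, k - 2}` of points that lie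
on fewer than three triples. -/
theorem low_degree_map {τ θ : Equiv.Perm (Fin (k + 1))}
    (h : ∀ p j, p ∈ triples k j ↔ τ p ∈ triples k (θ j)) {p : Fin (k + 1)}
    (hp : (p : ℕ) = 0 ∨ (p : ℕ) + 1 = k ∨ (p : ℕ) + 2 = k) :
    (τ p : ℕ) = 0 ∨ (τ p : ℕ) + 1 = k ∨ (τ p : ℕ) + 2 = k := by
  by_contra! hτ
  obtain ⟨i, j, l, hij, hjl, hl, hi, hj, hl'⟩ :=
    exists_three_triples hk (Nat.lt_succ_iff.1 (τ p).2) hτ.1 hτ.2.1 hτ.2.2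
  have back : ∀ x (hx : x < k + 1), Inc k (τ p) x → Inc k p (θ.symm ⟨x, hx⟩) := by
    intro x hx hinc
    rw [← mem_triples, h, Equiv.apply_symm_apply, mem_triples]
    exact hinc
  have ne : ∀ x y (hx : x < k + 1) (hy : y < k + 1), x < y →
      (θ.symm ⟨x, hx⟩ : ℕ) ≠ θ.symm ⟨y, hy⟩ := by
    intro x y hx hy hxy e
    have := θ.symm.injective (Fin.ext e)
    rw [Fin.mk.injEq] at this
    omega
  exact Inc.not_three hk hp (ne i j (by omega) (by omega) hij)
    (ne i l (by omega) (by omega) (by omega)) (ne j l (by omega) (by omega) hjl)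
    (back i _ hi) (back j _ hj) (back l _ hl')

set_option maxHeartbeats 800000 in
/-- A collineation of the triple system that preserves the low points `0, k - 1, k - 2` is
the identity. Among these points only `0` and `k - 1` are collinear, so `k - 2` is fixed, and so is
the third point `k` of the triple of `0` and `k - 1`; the remaining points are obtained one
after another as third points of triples with two fixed points. -/
theorem Inc.collineation_eq (f : ℕ → ℕ)
    (hinj : ∀ m n, m ≤ k → n ≤ k → m ≠ n → f m ≠ f n)
    (hlow : ∀ n, n ≤ k → (n = 0 ∨ n + 1 = k ∨ n + 2 = k) → (f n = 0 ∨ f n + 1 = k ∨ f n + 2 = k))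
    (hf : ∀ j ≤ k, ∃ j' ≤ k, ∀ p ≤ k, Inc k p j → Inc k (f p) j') :
    ∀ n ≤ k, f n = n := by
  have hset : ∀ j p q r, j ≤ k → p ≤ k → q ≤ k → r ≤ k → p ≠ q → Inc k p j → Inc k q j →
      Inc k r j → Inc k (f p) j → Inc k (f q) j → Inc k (f r) j := by
    intro j p q r hj hp hq hr hpq ip iq ir ip' iq'
    obtain ⟨j', -, h⟩ := hf j hj
    have hne := hinj p q hp hq hpq
    have : j' = j := by
      rcases lt_or_gt_of_ne hne with hlt | hlt
      · exact Inc.unique hk hlt (h p hp ip) (h q hq iq) ip' iq'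
      · exact Inc.unique hk hlt (h q hq iq) (h p hp ip) iq' ip'
    exact this ▸ h r hr ir
  have hfix : ∀ j p q r, j ≤ k → p ≤ k → q ≤ k → r ≤ k → p ≠ q → p ≠ r → q ≠ r →
      Inc k p j ∧ Inc k q j ∧ Inc k r j → f p = p → f q = q → f r = r := by
    rintro j p q r hj hp hq hr hpq hpr hqr ⟨ip, iq, ir⟩ ep eq
    have h := hset j p q r hj hp hq hr hpq ip iq ir (by rwa [ep]) (by rwa [eq])
    have n₁ := hinj p r hp hr hpr
    have n₂ := hinj q r hq hr hqr
    obtain ⟨a, b, c, -, -, -, hpts⟩ := Inc.exists_points hk hj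
    rw [hpts] at ip iq ir h
    omega
  obtain ⟨fk, f1, f0, fa⟩ : f k = k ∧ f 1 = 1 ∧ f 0 = 0 ∧ f (k - 1) = k - 1 := by
    have dz := hlow 0 (by omega) (by omega)
    have da := hlow (k - 1) (by omega) (by omega)
    have db := hlow (k - 2) (by omega) (by omega)
    have nza := hinj 0 (k - 1) (by omega) (by omega) (by omega)
    have nzb := hinj 0 (k - 2) (by omega) (by omega) (by omega)
    have nab := hinj (k - 1) (k - 2) (by omega) (by omega) (by omega)
    have hX : Inc k 0 (k - 3) ∧ Inc k (k - 1) (k - 3) ∧ Inc k k (k - 3) := by unfold Inc; omega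
    have hzb : f 0 + 2 ≠ k ∧ f (k - 1) + 2 ≠ k := by
      obtain ⟨x, hx, h⟩ := hf (k - 3) (by omega)
      have h₁ := h _ (by omega) hX.1
      have h₂ := h _ (by omega) hX.2.1
      unfold Inc at h₁ h₂
      omega
    have fb : f (k - 2) = k - 2 := by omega
    have fk : f k = k := by
      have h := hset (k - 3) 0 (k - 1) k (by omega) (by omega) (by omega) le_rfl (by omega)
        hX.1 hX.2.1 hX.2.2 (by unfold Inc; omega) (by unfold Inc; omega)
      have n₁ := hinj 0 k (by omega) (by omega) (by omega)
      have n₂ := hinj (k - 1) k (by omega) (by omega) (by omega)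
      unfold Inc at h
      omega
    have f1 : f 1 = 1 :=
      hfix (k - 2) (k - 2) k 1 (by omega) (by omega) (by omega) (by omega) (by omega) (by omega)
        (by omega) (by unfold Inc; omega) fb fk
    -- `0` is collinear with `1`, and `k - 1` is not
    have f0 : f 0 = 0 := by
      obtain ⟨y, hy, h⟩ := hf 0 (by omega)
      have h₁ := h 0 (by omega) (by unfold Inc; omega)
      have h₂ := h 1 (by omega) (by unfold Inc; omega)
      rw [f1] at h₂
      unfold Inc at h₁ h₂
      omega
    have fa : f (k - 1) = k - 1 := by omega
    exact ⟨fk, f1, f0, fa⟩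
  have f3 : f 3 = 3 :=
    hfix 0 0 1 3 (by omega) (by omega) (by omega) (by omega) (by omega) (by omega)
      (by omega) (by unfold Inc; omega) f0 f1
  have fk3 : f (k - 3) = k - 3 :=
    hfix k 3 k (k - 3) (by omega) (by omega) (by omega) (by omega) (by omega) (by omega)
      (by omega) (by unfold Inc; omega) f3 fk
  have fk4 : f (k - 4) = k - 4 :=
    hfix (k - 4) (k - 1) (k - 3) (k - 4) (by omega) (by omega) (by omega) (by omega) (by omega)
      (by omega) (by omega) (by unfold Inc; omega) fa fk3
  have f2 : f 2 = 2 :=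
    hfix (k - 1) (k - 4) k 2 (by omega) (by omega) (by omega) (by omega) (by omega) (by omega)
      (by omega) (by unfold Inc; omega) fk4 fk
  intro n
  induction n using Nat.strong_induction_on with
  | _ n ih =>
    intro hn
    have hcases : n = 0 ∨ n = 1 ∨ n = 2 ∨ n = k ∨ (3 ≤ n ∧ n < k) := by omega
    rcases hcases with rfl | rfl | rfl | rfl | h3
    · exact f0
    · exact f1
    · exact f2
    · exact fk
    · exact hfix (n - 3) (n - 3) (n - 2) n (by omega) (by omega) (by omega) (by omega) (by omega)
        (by omega) (by omega) (by unfold Inc; omega) (ih (n - 3) (by omega) (by omega))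
        (ih (n - 2) (by omega) (by omega))

theorem triples_asymmetric (τ θ : Equiv.Perm (Fin (k + 1)))
    (h : ∀ p j, p ∈ triples k j ↔ τ p ∈ triples k (θ j)) (p : Fin (k + 1)) : τ p = p := by
  let f : ℕ → ℕ := fun n => τ (Fin.ofNat (k + 1) n)
  have val : ∀ n ≤ k, (Fin.ofNat (k + 1) n : ℕ) = n := fun n hn =>
    Nat.mod_eq_of_lt (Nat.lt_succ_of_le hn)
  have key := Inc.collineation_eq hk f
    (fun m n hm hn hmn e => hmn (by
      rw [← val m hm, ← val n hn, τ.injective (Fin.ext e)]))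
    (fun n hn hD => low_degree_map hk h (by rwa [val n hn]))
    (fun j hj => ⟨θ (Fin.ofNat (k + 1) j), Nat.lt_succ_iff.1 (Fin.is_lt _), fun p hp hinc => by
      refine mem_triples.1 ((h _ _).1 (mem_triples.2 ?_))
      rwa [val p hp, val j hj]⟩)
    p (Nat.lt_succ_iff.1 p.2)
  have hp : Fin.ofNat (k + 1) p = p := Fin.ext (val p (Nat.lt_succ_iff.1 p.2))
  apply Fin.ext
  simpa only [f, hp] using key

end

end TwoFold

/-! ### The count of two-fold isomorphic graphs -/

theorem mainTheorem7 (k : ℕ) (hk : 13 ≤ k) :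
    ∃ Γ : SimpleGraph (TwoFold.Z2Pow k),
      Γ.Connected ∧ TwoFold.IsReduced Γ ∧ ¬ Γ.IsBipartite ∧
      TwoFold.HasValency Γ (2 * k + 2) ∧ TwoFold.IsGRR (TwoFold.Z2Pow k) Γ ∧
      -- there are exactly `2 ^ k - 2 * k - 2` isomorphism classes of graphs TF-isomorphic to `Γ`
      (∃ F : Fin (2 ^ k - 2 * k - 2) → SimpleGraph (TwoFold.Z2Pow k),
        (∀ i, TwoFold.TFIsomorphic Γ (F i)) ∧
        (∀ i j, Nonempty (F i ≃g F j) → i = j) ∧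
        (∀ (W : Type*) (Γ' : SimpleGraph W), TwoFold.TFIsomorphic Γ Γ' →
          ∃ i, Nonempty (Γ' ≃g F i))) ∧
      -- and every one of them is a stable Cayley graph
      (∀ (W : Type*) (Γ' : SimpleGraph W), TwoFold.TFIsomorphic Γ Γ' →
        TwoFold.IsStable Γ' ∧ TwoFold.IsCayleyGraphOf (TwoFold.Z2Pow k) Γ') := by
  classical
  have hA : ∀ x : TwoFold.Z2Pow k, x * x = 1 := TwoFold.z2Pow_mul_self
  have hT := TwoFold.isSparse_triples hk
  let S := TwoFold.connSet (TwoFold.triples k)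
  have h1 : (1 : TwoFold.Z2Pow k) ∉ S := TwoFold.one_notMem_connSet hT (by omega)
  have hg : TwoFold.PairGenerates S := TwoFold.pairGenerates_connSet _
  have hS : TwoFold.TFRigid S := TwoFold.tfRigid_connSet hT (TwoFold.exists_two_triples hk)
    (TwoFold.triples_asymmetric hk)
  have hcard : S.ncard = 2 * k + 2 := TwoFold.ncard_connSet hT (Fintype.card_fin _)
  have hne : S.Nonempty := ⟨_, Sum.inl (Fin.last k), rfl⟩
  -- the graphs two-fold isomorphic to `Γ` are indexed by the elements outside the connection set
  have hcompl : Nat.card (Sᶜ : Set (TwoFold.Z2Pow k)) = 2 ^ k - 2 * k - 2 := by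
    have h := Set.ncard_add_ncard_compl S
    rw [hcard, Nat.card_eq_fintype_card, Fintype.card_multiplicative, Fintype.card_fun,
      ZMod.card, Fintype.card_fin] at h
    rw [Nat.card_coe_set_eq]
    omega
  let e : Fin (2 ^ k - 2 * k - 2) ≃ (Sᶜ : Set (TwoFold.Z2Pow k)) :=
    (finCongr hcompl.symm).trans (Finite.equivFin _).symm
  refine ⟨SimpleGraph.mulCayley S, hg.connected hA h1, hS.isReduced hA h1,
    hg.not_isBipartite hA h1 hne, TwoFold.hasValency_cayley hA h1 hcard, hS.isGRR hA h1,
    ⟨fun i => SimpleGraph.mulCayley (TwoFold.shiftSet S (e i)), ?_, ?_, ?_⟩, ?_⟩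
  · exact fun i => TwoFold.tfIsomorphic_shift hA h1 (e i).2
  · exact fun i j h => e.injective (Subtype.ext (hS.shift_iso_unique hA (e i).2 (e j).2 h))
  · intro W Γ' h
    obtain ⟨a, ha, hiso⟩ := hS.exists_iso_shift hA h1 h
    refine ⟨e.symm ⟨a, ha⟩, ?_⟩
    simpa using hiso
  · intro W Γ' h
    obtain ⟨a, ha, ⟨φ⟩⟩ := hS.exists_iso_shift hA h1 h
    have h1' : (1 : TwoFold.Z2Pow k) ∉ TwoFold.shiftSet S a := by simpa [TwoFold.shiftSet] using ha
    have hne' : (TwoFold.shiftSet S a).Nonempty := by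
      obtain ⟨s, hs⟩ := hne
      exact ⟨a * s, by simpa [TwoFold.shiftSet, TwoFold.mul_self_mul hA] using hs⟩
    refine ⟨((hS.shift hA a).isStable hA h1' hne' (hg.shift hA a)).congr φ.symm,
      ⟨TwoFold.shiftSet S a, h1', fun s hs => ?_, ⟨φ⟩⟩⟩
    rwa [TwoFold.inv_eq_self_of_exponent_two hA]
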